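/- Let $\mathbf{k}$ be a field or the ring $\mathbb{Z}$, let $K$ be a simplicial complex on the set $[m]=\{1,\dots,m\}$ (so $\varnothing\in K$; not every element of $[m]$ need be a vertex of $K$), and let $\mathbb{P}$ be a simplicial complement of $K$, i.e. a set of subsets $\tau\subseteq[m]$ with $\tau\notin K$ that contains every missing face of $K$ (a missing face is a $\tau\subseteq[m]$ with $\tau\notin K$ all of whose proper subsets are in $K$). Let $\Lambda^*[\mathbb{P}]$ be the exterior algebra over $\mathbf{k}$ generated by the elements of $\mathbb{P}$. For a monomial $\mathbf{u}=\tau_{1}\tau_{2}\cdots\tau_{n}$ put $S_{\mathbf{u}}=\tau_{1}\cup\dots\cup\tau_{n}$, and for $i\ge 0$ and $J\subseteq[m]$ let $\Lambda^{i,J}[\mathbb{P}]$ be the submodule spanned by the monomials $\mathbf{u}$ of degree $i$ with $S_{\mathbf{u}}=J$. Let $d:\Lambda^{n,J}[\mathbb{P}]\to\Lambda^{n-1,J}[\mathbb{P}]$ be the differential $$d(\tau_1\cdots\tau_n)=\sum_{j=1}^n(-1)^{j+1}\,\delta_j\;\tau_1\cdots\widehat{\tau_j}\cdots\tau_n,$$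 where $\delta_j=1$ if omitting $\tau_j$ does not change the union $S_{\mathbf{u}}$, and $\delta_j=0$ otherwise. Then for every $J\subseteq[m]$ and every $i\ge 0$ there is an isomorphism of $\mathbf{k}$-modules $$H_i\big(\Lambda^{*,J}[\mathbb{P}],d\big)\;\cong\;\widetilde{H}^{\,|J|-i-1}(K_J;\mathbf{k}),$$ where $K_J=\{\sigma\in K\mid\sigma\subseteq J\}$ is the full subcomplex of $K$ on $J$ and $\widetilde H^*$ is reduced simplicial cohomology (with $\widetilde H^{-1}(\{\varnothing\};\mathbf{k})=\mathbf{k}$, and $\widetilde H^{n}=0$ for $n<-1$). -/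

import Mathlib

namespace SimplicialComplement

noncomputable section

/-! ### Signs -/

/-- The sign `(-1)^(j+1)`, where `a` is the `j`-th element (`j = 1, 2, …`) of the finite set `s`
in increasing order; that is, `-1` to the number of elements of `s` which are smaller than `a`. -/
def sgn (k : Type*) [CommRing k] {I : Type*} [LinearOrder I] (s : Finset I) (a : I) : k :=
  (-1) ^ (s.filter (· < a)).card

/-- The sign cancellation behind `∂ ∘ ∂ = 0` for alternating sums over faces. -/
theorem sgn_mul_sgn_erase (k : Type*) [CommRing k] {I : Type*} [LinearOrder I] [DecidableEq I]
    (s : Finset I) {a b : I} (ha : a ∈ s) (hb : b ∈ s) (hab : a ≠ b) :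
    sgn k s a * sgn k (s.erase a) b = -(sgn k s b * sgn k (s.erase b) a) := by
  wlog h : a < b generalizing a b
  · rw [this hb ha hab.symm (lt_of_le_of_ne (not_lt.mp h) hab.symm), neg_neg]
  have h1 : (s.filter (· < b)).erase a = (s.erase a).filter (· < b) := by
    ext x; simp only [Finset.mem_erase, Finset.mem_filter]; tauto
  have h2 : (s.erase b).filter (· < a) = s.filter (· < a) := by
    ext x; simp only [Finset.mem_erase, Finset.mem_filter]
    constructor
    · rintro ⟨⟨_, hx⟩, hxa⟩; exact ⟨hx, hxa⟩
    · rintro ⟨hx, hxa⟩; exact ⟨⟨(hxa.trans h).ne, hx⟩, hxa⟩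
  have h3 : (s.filter (· < b)).card = ((s.erase a).filter (· < b)).card + 1 := by
    rw [← h1, Finset.card_erase_add_one (by simp [ha, h])]
  simp only [sgn, h2, h3, pow_succ]
  ring

/-- An alternating double sum over faces of codimension two vanishes. -/
theorem sum_sgn_sgn {k : Type*} [CommRing k] {I : Type*} [LinearOrder I] [DecidableEq I]
    {M : Type*} [AddCommGroup M] [Module k M] (s : Finset I) (F : I → I → M)
    (hF : ∀ a ∈ s, ∀ b ∈ s, F a b = F b a) :
    ∑ a ∈ s, sgn k s a • ∑ b ∈ s.erase a, sgn k (s.erase a) b • F a b = 0 := by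
  simp only [Finset.smul_sum, smul_smul]
  rw [Finset.sum_sigma']
  refine Finset.sum_involution (fun x _ => ⟨x.2, x.1⟩) ?_ ?_ ?_ ?_
  · rintro ⟨a, b⟩ h
    simp only [Finset.mem_sigma, Finset.mem_erase] at h
    rw [hF b h.2.2 a h.1, sgn_mul_sgn_erase k s h.1 h.2.2 (Ne.symm h.2.1), neg_smul]
    exact neg_add_cancel _
  · rintro ⟨a, b⟩ h _ heq
    simp only [Finset.mem_sigma, Finset.mem_erase] at h
    exact h.2.1 (congrArg Sigma.fst heq)
  · rintro ⟨a, b⟩ h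
    simp only [Finset.mem_sigma, Finset.mem_erase] at h ⊢
    exact ⟨h.2.2, Ne.symm h.2.1, h.1⟩
  · rintro ⟨a, b⟩ _
    rfl

/-! ### Simplicial complexes, missing faces and simplicial complements

Mathlib's `PreAbstractSimplicialComplex V` records the nonempty simplices, and does not require
the elements of `V` to be vertices. As usual the empty set counts as a simplex. -/

section Complexes

variable {V : Type*}

/-- `σ` is a simplex of `K`; the empty set is a simplex of every simplicial complex. -/
def IsSimplex (K : PreAbstractSimplicialComplex V) (σ : Finset V) : Prop :=
  σ = ∅ ∨ σ ∈ K

theorem IsSimplex.mono {K : PreAbstractSimplicialComplex V} {σ ρ : Finset V}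
    (hσ : IsSimplex K σ) (h : ρ ⊆ σ) : IsSimplex K ρ := by
  rcases ρ.eq_empty_or_nonempty with h0 | h0
  · exact Or.inl h0
  · rcases hσ with rfl | hσ
    · exact Or.inl (Finset.subset_empty.mp h)
    · exact Or.inr ((K.isRelLowerSet_faces hσ).2 h h0)

/-- `τ` is a missing face of `K`: it is not a simplex, but all its proper subsets are. -/
def IsMissingFace (K : PreAbstractSimplicialComplex V) (τ : Finset V) : Prop :=
  ¬ IsSimplex K τ ∧ ∀ ρ, ρ ⊂ τ → IsSimplex K ρ

/-- `P` is a simplicial complement of `K`: a set of non-simplices that contains all missing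
faces of `K`. -/
def IsSimplicialComplement (K : PreAbstractSimplicialComplex V) (P : Set (Finset V)) : Prop :=
  (∀ τ ∈ P, ¬ IsSimplex K τ) ∧ ∀ τ, IsMissingFace K τ → τ ∈ P

/-- The full subcomplex `K_J` of `K` on the vertex set `J`: all simplices of `K` inside `J`. -/
def fullSubcomplex (K : PreAbstractSimplicialComplex V) (J : Finset V) :
    PreAbstractSimplicialComplex V where
  faces := {σ | σ ∈ K ∧ σ ⊆ J}
  isRelLowerSet_faces := fun _ hσ =>
    ⟨(K.isRelLowerSet_faces hσ.1).1, fun _ h h0 =>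
      ⟨(K.isRelLowerSet_faces hσ.1).2 h h0, h.trans hσ.2⟩⟩

end Complexes

/-! ### Reduced simplicial cohomology -/

section Cohomology

variable (k : Type*) [CommRing k] {V : Type*} [LinearOrder V]
  (K : PreAbstractSimplicialComplex V)

/-- All cochains: `k`-valued functions on the simplices of `K`, the empty simplex included.
A simplex is oriented by the order of `V`. -/
abbrev Cochain : Type _ := {σ : Finset V // IsSimplex K σ} → k

/-- The cochains of degree `n`: those that vanish outside the simplices of dimension `n`, i.e.
with `n + 1` vertices. In degree `-1` there is just the empty simplex. -/
def cochains (n : ℤ) : Submodule k (Cochain k K) where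
  carrier := {f | ∀ σ, (σ.1.card : ℤ) ≠ n + 1 → f σ = 0}
  zero_mem' := fun _ _ => rfl
  add_mem' := fun {f g} hf hg σ h => by
    simp [hf σ h, hg σ h]
  smul_mem' := fun c f hf σ h => by
    simp [hf σ h]

/-- The simplicial coboundary
`(δ f)[v₀, …, vₙ] = ∑ⱼ (-1)^j f[v₀, …, v̂ⱼ, …, vₙ]`, for `v₀ < … < vₙ`. -/
def coboundary : Cochain k K →ₗ[k] Cochain k K where
  toFun f σ := ∑ v ∈ σ.1, sgn k σ.1 v * f ⟨σ.1.erase v, σ.2.mono (Finset.erase_subset _ _)⟩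
  map_add' f g := by
    funext σ
    simp [mul_add, Finset.sum_add_distrib]
  map_smul' c f := by
    funext σ
    simp [Finset.mul_sum, mul_left_comm]

theorem coboundary_coboundary (f : Cochain k K) : coboundary k K (coboundary k K f) = 0 := by
  funext σ
  refine sum_sgn_sgn (k := k) (M := k) σ.1 (fun a b => f ⟨(σ.1.erase a).erase b,
    σ.2.mono ((Finset.erase_subset _ _).trans (Finset.erase_subset _ _))⟩) ?_
  intro a _ b _
  simp only [Finset.erase_right_comm]

theorem coboundary_mem {n : ℤ} {f : Cochain k K} (hf : f ∈ cochains k K n) :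
    coboundary k K f ∈ cochains k K (n + 1) := by
  intro σ hσ
  refine Finset.sum_eq_zero fun v hv => ?_
  rw [hf, mul_zero]
  have := Finset.card_erase_add_one hv
  simp only
  omega

/-- The cocycles of degree `n`. -/
def cocycles (n : ℤ) : Submodule k (Cochain k K) :=
  LinearMap.ker (coboundary k K) ⊓ cochains k K n

/-- The coboundaries of degree `n`. -/
def coboundaries (n : ℤ) : Submodule k (Cochain k K) :=
  (cochains k K (n - 1)).map (coboundary k K)

theorem coboundaries_le_cocycles (n : ℤ) : coboundaries k K n ≤ cocycles k K n := by
  rintro _ ⟨f, hf, rfl⟩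
  refine ⟨LinearMap.mem_ker.mpr (coboundary_coboundary k K f), ?_⟩
  simpa using coboundary_mem k K hf

/-- The reduced simplicial cohomology `H̃ⁿ(K; k)`, for every integer `n`. -/
abbrev ReducedCohomology (n : ℤ) : Type _ :=
  cocycles k K n ⧸ (coboundaries k K n).submoduleOf (cocycles k K n)

end Cohomology

/-! ### The exterior algebra on a simplicial complement -/

section Exterior

variable (k : Type*) [CommRing k] {V : Type*} [LinearOrder V] (P : Set (Finset V))

/-- The generators: the elements of `P`, put in the colexicographic order of finite sets. The
order only selects which of the two signed versions of a monomial serves as a basis element. -/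
abbrev Gen : Type _ := {τ : Colex (Finset V) // ofColex τ ∈ P}

/-- The exterior algebra `Λ*[P]` over `k` generated by the elements of `P`. -/
abbrev Lam : Type _ := ExteriorAlgebra k (Gen P →₀ k)

/-- The basis of `Λ*[P]` by the monomials `τ₁ τ₂ ⋯ τₙ`, `τ₁ < τ₂ < ⋯ < τₙ` in `P`; the monomial
is indexed by the set `{τ₁, …, τₙ}` of its factors. -/
def monomial : Module.Basis (Finset (Gen P)) k (Lam k P) :=
  (Finsupp.basisSingleOne : Module.Basis (Gen P) k (Gen P →₀ k)).ExteriorAlgebra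

theorem monomial_eq_prod (s : Finset (Gen P)) :
    monomial k P s =
      ((s.sort (· ≤ ·)).map fun τ => ExteriorAlgebra.ι k (Finsupp.single τ (1 : k))).prod := by
  unfold monomial
  rw [ExteriorAlgebra.basis_apply]
  change ExteriorAlgebra.ιMulti k _ _ = _
  rw [ExteriorAlgebra.ιMulti_apply]
  congr 1
  simp only [List.ofFn_eq_map]
  apply List.ext_getElem <;> simp
  intro i h1
  congr

variable {P} in
/-- The total set of a monomial: the union of its factors. -/
def totalSet (s : Finset (Gen P)) : Finset V :=
  s.biUnion fun τ => ofColex τ.1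

/-- The summand `Λ^{i,J}[P]`, spanned by the monomials of degree `i` with total set `J`. -/
def LamPart (i : ℕ) (J : Finset V) : Submodule k (Lam k P) :=
  Submodule.span k {u | ∃ s : Finset (Gen P), s.card = i ∧ totalSet s = J ∧ u = monomial k P s}

/-- The differential: `d(τ₁ ⋯ τₙ) = ∑ⱼ (-1)^(j+1) δⱼ τ₁ ⋯ τ̂ⱼ ⋯ τₙ`, where `δⱼ = 1` if leaving out
`τⱼ` does not change the total set, and `δⱼ = 0` otherwise. -/
def d : Lam k P →ₗ[k] Lam k P :=
  (monomial k P).constr k fun s => ∑ τ ∈ s, sgn k s τ •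
    if totalSet (s.erase τ) = totalSet s then monomial k P (s.erase τ) else 0

theorem d_monomial (s : Finset (Gen P)) :
    d k P (monomial k P s) = ∑ τ ∈ s, sgn k s τ •
      if totalSet (s.erase τ) = totalSet s then monomial k P (s.erase τ) else 0 :=
  (monomial k P).constr_basis k _ s

variable {P} in
theorem totalSet_mono {s t : Finset (Gen P)} (h : s ⊆ t) : totalSet s ⊆ totalSet t :=
  Finset.biUnion_subset_biUnion_of_subset_left _ h

theorem d_d (x : Lam k P) : d k P (d k P x) = 0 := by
  suffices h : d k P ∘ₗ d k P = 0 from LinearMap.congr_fun h x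
  refine (monomial k P).ext fun s => ?_
  rw [LinearMap.comp_apply, d_monomial, map_sum, LinearMap.zero_apply]
  refine Eq.trans ?_ (sum_sgn_sgn (k := k) s (fun a b =>
    if totalSet ((s.erase a).erase b) = totalSet s then monomial k P ((s.erase a).erase b)
      else 0) (fun a _ b _ => by rw [Finset.erase_right_comm]))
  refine Finset.sum_congr rfl fun a _ => ?_
  rw [map_smul]
  congr 1
  have hsub : ∀ b, totalSet ((s.erase a).erase b) ⊆ totalSet (s.erase a) :=
    fun b => totalSet_mono (Finset.erase_subset _ _)
  by_cases h : totalSet (s.erase a) = totalSet s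
  · rw [if_pos h, d_monomial, h]
  · rw [if_neg h, map_zero]
    refine (Finset.sum_eq_zero fun b _ => ?_).symm
    rw [if_neg, smul_zero]
    intro h'
    exact h ((totalSet_mono (Finset.erase_subset _ _)).antisymm (h' ▸ hsub b))

theorem d_mem {i : ℕ} {J : Finset V} {x : Lam k P} (hx : x ∈ LamPart k P (i + 1) J) :
    d k P x ∈ LamPart k P i J := by
  suffices h : LamPart k P (i + 1) J ≤ (LamPart k P i J).comap (d k P) from h hx
  refine Submodule.span_le.mpr ?_
  rintro _ ⟨s, hs, hJ, rfl⟩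
  change d k P _ ∈ LamPart k P i J
  rw [d_monomial]
  refine Submodule.sum_mem _ fun τ hτ => Submodule.smul_mem _ _ ?_
  split_ifs with h
  · refine Submodule.subset_span ⟨_, ?_, h.trans hJ, rfl⟩
    have := Finset.card_erase_add_one hτ
    omega
  · exact Submodule.zero_mem _

/-- The cycles of `(Λ^{*,J}[P], d)` in degree `i`. -/
def cycles (i : ℕ) (J : Finset V) : Submodule k (Lam k P) :=
  LinearMap.ker (d k P) ⊓ LamPart k P i J

/-- The boundaries of `(Λ^{*,J}[P], d)` in degree `i`. -/
def boundaries (i : ℕ) (J : Finset V) : Submodule k (Lam k P) :=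
  (LamPart k P (i + 1) J).map (d k P)

theorem boundaries_le_cycles (i : ℕ) (J : Finset V) : boundaries k P i J ≤ cycles k P i J := by
  rintro _ ⟨x, hx, rfl⟩
  exact ⟨LinearMap.mem_ker.mpr (d_d k P x), d_mem k P hx⟩

/-- The homology `H_i(Λ^{*,J}[P], d)`. -/
abbrev LamHomology (i : ℕ) (J : Finset V) : Type _ :=
  cycles k P i J ⧸ (boundaries k P i J).submoduleOf (cycles k P i J)

end Exterior

end

end SimplicialComplement

namespace SimplicialComplement

noncomputable section

/-! ### Homology isomorphisms induced by surjective chain maps with acyclic kernel -/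

/-! Both sides are the homology of quotients of one complex by acyclic subcomplexes. The simplices
of `bicomplex` are pairs of a set `s` of generators and a set `A ⊆ J` disjoint from the union of
`s`, which must lie in `J`.

If `s` does not cover `J`, any uncovered element of `J` can be added to `A`, and its choice depends
on `s` only. If `J \ A` is not a simplex of `K`, some element of `P` inside it can be added to `s`,
and its choice depends on `A` only. Such a parametrised cone is contractible, by induction on the
size of the part that governs the choice (`exists_boundary_eq`), so `nonCovering` and
`nonSimplicial` are acyclic.

Modulo `nonCovering`, only pairs with `s` covering `J` survive. Then `A = ∅`, and the quotient is
`Λ^{*,J}[P]` with its differential (`toLam`). Modulo `nonSimplicial`, only pairs with `J \ A ∈ K`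
survive. Then `s = ∅`, since no element of `P` is a simplex, and passing from `A` to `J \ A` turns
boundaries into coboundaries of `K_J` up to sign (`toCochain`). By `nonempty_homologyEquiv` both
quotients have the homology of the whole complex. -/

/-- A chain map, surjective in the relevant degrees and with acyclic kernel, induces an
isomorphism in homology. -/
theorem nonempty_homologyEquiv {k M N : Type*} [CommRing k] [AddCommGroup M] [Module k M]
    [AddCommGroup N] [Module k N] (D : M →ₗ[k] M) (E : N →ₗ[k] N) (f : M →ₗ[k] N)
    (A₀ A₁ A₂ : Submodule k M) (B₁ B₂ : Submodule k N) (hDD : ∀ x, D (D x) = 0)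
    (h₁₀ : ∀ x ∈ A₁, D x ∈ A₀) (h₂₁ : ∀ x ∈ A₂, D x ∈ A₁)
    (hf₁ : ∀ x ∈ A₁, f (D x) = E (f x)) (hf₂ : ∀ x ∈ A₂, f (D x) = E (f x))
    (hB₁ : A₁.map f = B₁) (hB₂ : A₂.map f = B₂)
    (hker₀ : ∀ x ∈ A₀, f x = 0 → D x = 0 → ∃ y ∈ A₁, f y = 0 ∧ D y = x)
    (hker₁ : ∀ x ∈ A₁, f x = 0 → D x = 0 → ∃ y ∈ A₂, f y = 0 ∧ D y = x) :
    Nonempty ((↥(LinearMap.ker D ⊓ A₁) ⧸ (A₂.map D).submoduleOf (LinearMap.ker D ⊓ A₁)) ≃ₗ[k]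
      (↥(LinearMap.ker E ⊓ B₁) ⧸ (B₂.map E).submoduleOf (LinearMap.ker E ⊓ B₁))) := by
  subst hB₁ hB₂
  have hmaps : ∀ x ∈ LinearMap.ker D ⊓ A₁, f x ∈ LinearMap.ker E ⊓ A₁.map f := by
    rintro x ⟨hx, hx'⟩
    refine ⟨?_, Submodule.mem_map_of_mem hx'⟩
    change E (f x) = 0
    rw [← hf₁ x hx', show D x = 0 from hx, map_zero]
  let φ := f.restrict hmaps
  let ψ := ((A₂.map f).map E |>.submoduleOf (LinearMap.ker E ⊓ A₁.map f)).mkQ ∘ₗ φ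
  have hψ : Function.Surjective ψ := by
    refine (Submodule.mkQ_surjective _).comp ?_
    rintro ⟨_, hb, a, ha, rfl⟩
    -- `D a` is a cycle in the kernel, so it bounds some `y` there; `a - y` is then a cycle with the
    -- same image as `a`.
    have hDa : f (D a) = 0 := (hf₁ a ha).trans hb
    obtain ⟨y, hy, hfy, hDy⟩ := hker₀ (D a) (h₁₀ a ha) hDa (hDD a)
    refine ⟨⟨a - y, ?_, sub_mem ha hy⟩, ?_⟩
    · simp [hDy]
    · apply Subtype.ext
      change f (a - y) = f a
      simp [hfy]
  have hkerψ : LinearMap.ker ψ = (A₂.map D).submoduleOf (LinearMap.ker D ⊓ A₁) := by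
    ext ⟨x, hx⟩
    rw [LinearMap.mem_ker]
    change Submodule.Quotient.mk (φ ⟨x, hx⟩) = 0 ↔ x ∈ A₂.map D
    rw [Submodule.Quotient.mk_eq_zero]
    change f x ∈ (A₂.map f).map E ↔ _
    constructor
    · rintro ⟨_, ⟨a, ha, rfl⟩, hE⟩
      -- Now `x - D a` is a cycle in the kernel, hence a boundary.
      rw [← hf₂ a ha] at hE
      obtain ⟨y, hy, -, hDy⟩ := hker₁ (x - D a) (sub_mem hx.2 (h₂₁ a ha)) (by simp [hE])
        (by rw [map_sub, hDD, show D x = 0 from hx.1, sub_zero])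
      exact ⟨a + y, add_mem ha hy, by rw [map_add, hDy]; abel⟩
    · rintro ⟨a, ha, rfl⟩
      exact ⟨f a, ⟨a, ha, rfl⟩, (hf₂ a ha).symm⟩
  exact ⟨(Submodule.quotEquivOfEq _ _ hkerψ).symm.trans (ψ.quotKerEquivOfSurjective hψ)⟩

/-! ### The simplicial boundary on all finite subsets of an ordered set -/

section Boundary

variable (k : Type*) [CommRing k] {I : Type*} [LinearOrder I]

theorem sgn_mul_self (s : Finset I) (a : I) : sgn k s a * sgn k s a = 1 := by
  rw [sgn, ← pow_add, ← two_mul]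
  simp

/-- Signs depend only on relative positions. This lets the signs on generators and on ground
elements be computed in their common vertex set. -/
theorem sgn_map {I' : Type*} [LinearOrder I'] (e : I ↪o I') (s : Finset I) (a : I) :
    sgn k (s.map e.toEmbedding) (e a) = sgn k s a := by
  unfold sgn
  rw [Finset.filter_map, Finset.card_map]
  congr 3
  ext x
  simp

/-- The simplicial boundary on the free module on all finite subsets of `I`. -/
def boundary : (Finset I →₀ k) →ₗ[k] (Finset I →₀ k) :=
  Finsupp.linearCombination k fun t => ∑ y ∈ t, sgn k t y • Finsupp.single (t.erase y) 1

theorem boundary_single (t : Finset I) :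
    boundary k (Finsupp.single t 1) = ∑ y ∈ t, sgn k t y • Finsupp.single (t.erase y) 1 := by
  simp [boundary]

theorem boundary_boundary (x : Finset I →₀ k) : boundary k (boundary k x) = 0 := by
  suffices h : boundary k ∘ₗ boundary k = (0 : (Finset I →₀ k) →ₗ[k] _) from
    LinearMap.congr_fun h x
  refine Finsupp.lhom_ext' fun t => LinearMap.ext_ring ?_
  simp only [LinearMap.comp_apply, Finsupp.lsingle_apply, boundary_single, map_sum, map_smul,
    LinearMap.zero_apply]
  exact sum_sgn_sgn t (fun a b => Finsupp.single ((t.erase a).erase b) (1 : k))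
    fun a _ b _ => by rw [Finset.erase_right_comm]

/-- Only sets exceeding `u` by one vertex contribute. This coordinate form is the one that can be
compared with `coboundary`. -/
theorem boundary_apply [Fintype I] (x : Finset I →₀ k) (u : Finset I) :
    boundary k x u = ∑ y ∈ uᶜ, sgn k (insert y u) y * x (insert y u) := by
  induction x using Finsupp.induction_linear with
  | zero => simp
  | add x y hx hy => simp [hx, hy, mul_add, Finset.sum_add_distrib]
  | single t c =>
    rw [← mul_one c, ← smul_eq_mul, ← Finsupp.smul_single, map_smul, boundary_single]
    simp only [Finsupp.smul_apply, Finsupp.finsetSum_apply, Finsupp.single_apply, smul_eq_mul,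
      Finset.mul_sum]
    simp only [mul_ite, mul_one, mul_zero]
    rw [← Finset.sum_filter, ← Finset.sum_filter]
    have hset : t.filter (fun y => t.erase y = u) = uᶜ.filter (fun y => t = insert y u) := by
      ext y
      simp only [Finset.mem_filter, Finset.mem_compl]
      constructor
      · rintro ⟨hy, rfl⟩
        exact ⟨Finset.notMem_erase _ _, (Finset.insert_erase hy).symm⟩
      · rintro ⟨hy, rfl⟩
        exact ⟨Finset.mem_insert_self _ _, Finset.erase_insert hy⟩
    rw [hset]
    refine Finset.sum_congr rfl fun y hy => ?_
    rw [← (Finset.mem_filter.mp hy).2, mul_comm]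

/-- The chains of degree `n` on a family `X` of finite sets; a set of `n` elements has
degree `n`. -/
def chains (X : Set (Finset I)) (n : ℤ) : Submodule k (Finset I →₀ k) :=
  Finsupp.supported k k {t | t ∈ X ∧ (t.card : ℤ) = n}

omit [LinearOrder I] in
variable {k} in
theorem chains_le {X : Set (Finset I)} {n : ℤ} {S : Submodule k (Finset I →₀ k)}
    (h : ∀ t ∈ X, (t.card : ℤ) = n → Finsupp.single t 1 ∈ S) : chains k X n ≤ S := by
  rw [chains, Finsupp.supported_eq_span_single, Submodule.span_le]
  rintro _ ⟨t, ⟨ht, hn⟩, rfl⟩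
  exact h t ht hn

omit [LinearOrder I] in
theorem single_mem_chains {X : Set (Finset I)} {n : ℤ} {t : Finset I} (h : t ∈ X)
    (hn : (t.card : ℤ) = n) : Finsupp.single t 1 ∈ chains k X n :=
  Finsupp.single_mem_supported k 1 ⟨h, hn⟩

theorem boundary_mem_chains {X : Set (Finset I)} (hX : ∀ t ∈ X, ∀ y, t.erase y ∈ X) {n : ℤ}
    {x : Finset I →₀ k} (hx : x ∈ chains k X n) : boundary k x ∈ chains k X (n - 1) := by
  suffices h : chains k X n ≤ (chains k X (n - 1)).comap (boundary k) from h hx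
  refine chains_le fun t ht hn => ?_
  rw [Submodule.mem_comap, boundary_single]
  refine Submodule.sum_mem _ fun y hy => Submodule.smul_mem _ _ (single_mem_chains k (hX t ht y) ?_)
  have := Finset.card_erase_add_one hy
  omega

/-! ### Cones with a varying apex -/

/-- The cone operator adding the vertex `w t` to a set `t`. -/
def cone (w : Finset I → I) : (Finset I →₀ k) →ₗ[k] (Finset I →₀ k) :=
  Finsupp.linearCombination k fun t => if w t ∈ t then 0 else
    sgn k (insert (w t) t) (w t) • Finsupp.single (insert (w t) t) 1

theorem cone_single (w : Finset I → I) (t : Finset I) :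
    cone k w (Finsupp.single t 1) = if w t ∈ t then 0 else
      sgn k (insert (w t) t) (w t) • Finsupp.single (insert (w t) t) 1 := by
  simp [cone]

theorem cone_mem_chains {X : Set (Finset I)} {w : Finset I → I}
    (hw : ∀ t ∈ X, insert (w t) t ∈ X) {n : ℤ}
    {x : Finset I →₀ k} (hx : x ∈ chains k X n) : cone k w x ∈ chains k X (n + 1) := by
  suffices h : chains k X n ≤ (chains k X (n + 1)).comap (cone k w) from h hx
  refine chains_le fun t ht hn => ?_
  rw [Submodule.mem_comap, cone_single]
  split_ifs with h
  · exact zero_mem _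
  · refine Submodule.smul_mem _ _ (single_mem_chains k (hw t ht) ?_)
    rw [Finset.card_insert_of_notMem h]
    push_cast
    omega

/-- If the vertex set is divided in two, and the vertex added by the cone operator belongs to
one part and only depends on the other part, then the cone operator is a contracting homotopy up
to terms with fewer vertices in the other part. -/
theorem single_sub_homotopy_mem {X : Set (Finset I)} (hX : ∀ t ∈ X, ∀ y, t.erase y ∈ X)
    (p : I → Prop) [DecidablePred p] (w : Finset I → I)
    (hp : ∀ t ∈ X, p (w (t.filter (¬ p ·))))
    (hw : ∀ t ∈ X, insert (w (t.filter (¬ p ·))) t ∈ X) {t : Finset I} (ht : t ∈ X) :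
    Finsupp.single t 1 - boundary k (cone k (fun t => w (t.filter (¬ p ·))) (Finsupp.single t 1))
        - cone k (fun t => w (t.filter (¬ p ·))) (boundary k (Finsupp.single t 1)) ∈
      chains k {u | u ∈ X ∧ (u.filter (¬ p ·)).card < (t.filter (¬ p ·)).card} t.card := by
  set v : Finset I → I := fun t => w (t.filter (¬ p ·)) with hv
  set Y := chains k {u | u ∈ X ∧ (u.filter (¬ p ·)).card < (t.filter (¬ p ·)).card} t.card
  have hpt : p (v t) := hp t ht
  have hsame : ∀ y, p y → v (t.erase y) = v t := by
    intro y hy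
    simp only [hv]
    congr 1
    ext z
    simp only [Finset.mem_filter, Finset.mem_erase]
    constructor
    · tauto
    · rintro ⟨h1, h2⟩
      exact ⟨⟨fun h => h2 (h ▸ hy), h1⟩, h2⟩
  have hfi : ∀ (z : I) (u : Finset I), p z →
      (insert z u).filter (¬ p ·) = u.filter (¬ p ·) := by
    intro z u hz
    rw [Finset.filter_insert, if_neg (not_not.mpr hz)]
  have hlt : ∀ y ∈ t, ¬ p y →
      ((t.erase y).filter (¬ p ·)).card < (t.filter (¬ p ·)).card := by
    intro y hy hpy
    rw [Finset.filter_erase]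
    exact Finset.card_erase_lt_of_mem (by simp [hy, hpy])
  have hlow : ∀ y ∈ t, ¬ p y → cone k v (Finsupp.single (t.erase y) 1) ∈ Y := by
    intro y hy hpy
    rw [cone_single]
    split_ifs with h
    · exact zero_mem _
    · refine Submodule.smul_mem _ _ (single_mem_chains k ⟨hw _ (hX t ht y), ?_⟩ ?_)
      · rw [hfi _ _ (hp _ (hX t ht y))]
        exact hlt y hy hpy
      · rw [Finset.card_insert_of_notMem h, Finset.card_erase_add_one hy]
  rw [boundary_single, map_sum]
  simp only [map_smul]
  by_cases hvt : v t ∈ t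
  -- The cone on `t` vanishes here; erasing the apex and coning it back returns `t` with coefficient
  -- one.
  · rw [cone_single, if_pos hvt, map_zero, sub_zero, ← Finset.add_sum_erase _ _ hvt, cone_single,
      hsame _ hpt, if_neg (Finset.notMem_erase _ _), Finset.insert_erase hvt, smul_smul,
      sgn_mul_self, one_smul, sub_add_cancel_left]
    refine neg_mem (Submodule.sum_mem _ fun y hy => Submodule.smul_mem _ _ ?_)
    obtain ⟨hyv, hyt⟩ := Finset.mem_erase.mp hy
    by_cases hpy : p y
    · rw [cone_single, hsame y hpy, if_pos (Finset.mem_erase.mpr ⟨Ne.symm hyv, hvt⟩)]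
      exact zero_mem _
    · exact hlow y hyt hpy
  -- The sign in the cone makes `t` appear in the boundary of its cone with coefficient one. The
  -- remaining terms are paired by the vertex `y` erased.
  · rw [cone_single, if_neg hvt, map_smul, boundary_single, Finset.sum_insert hvt,
      Finset.erase_insert hvt, smul_add, smul_smul, sgn_mul_self, one_smul, sub_add_cancel_left,
      ← neg_add', Finset.smul_sum, ← Finset.sum_add_distrib]
    refine neg_mem (Submodule.sum_mem _ fun y hy => ?_)
    have hyv : v t ≠ y := fun h => hvt (h ▸ hy)
    by_cases hpy : p y
    · have hvy : v t ∉ t.erase y := fun h => hvt (Finset.mem_of_mem_erase h)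
      have hs := sgn_mul_sgn_erase k (insert (v t) t) (Finset.mem_insert_self _ _)
        (Finset.mem_insert_of_mem hy) hyv
      rw [Finset.erase_insert hvt, Finset.erase_insert_of_ne hyv] at hs
      rw [cone_single, hsame y hpy, if_neg hvy, Finset.erase_insert_of_ne hyv, smul_smul,
        smul_smul, ← add_smul]
      have h1 := sgn_mul_self k (insert (v t) t) (v t)
      have h2 := sgn_mul_self k (insert (v t) (t.erase y)) (v t)
      -- Multiply `hs` by the two signs at `v t`, whose squares are one.
      rw [show sgn k (insert (v t) t) (v t) * sgn k (insert (v t) t) y +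
          sgn k t y * sgn k (insert (v t) (t.erase y)) (v t) = 0 by
        linear_combination (sgn k (insert (v t) t) (v t) * sgn k (insert (v t) (t.erase y)) (v t)) * hs
          - sgn k t y * sgn k (insert (v t) (t.erase y)) (v t) * h1
          + sgn k (insert (v t) t) (v t) * sgn k (insert (v t) t) y * h2 * (-1), zero_smul]
      exact zero_mem _
    · refine add_mem (Submodule.smul_mem _ _ (Submodule.smul_mem _ _ ?_))
        (Submodule.smul_mem _ _ (hlow y hy hpy))
      refine single_mem_chains k ⟨hX _ (hw t ht) y, ?_⟩ ?_
      · rw [Finset.erase_insert_of_ne hyv, hfi _ _ hpt]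
        exact hlt y hy hpy
      · rw [Finset.card_erase_of_mem (Finset.mem_insert_of_mem hy),
          Finset.card_insert_of_notMem hvt, Nat.add_sub_cancel]

/-- A family of finite sets that is closed under removing elements is acyclic, if to each of its
members one can add a vertex from one part that only depends on the other part of the member. -/
theorem exists_boundary_eq {X : Set (Finset I)} (hX : ∀ t ∈ X, ∀ y, t.erase y ∈ X)
    (p : I → Prop) [DecidablePred p] (w : Finset I → I)
    (hp : ∀ t ∈ X, p (w (t.filter (¬ p ·))))
    (hw : ∀ t ∈ X, insert (w (t.filter (¬ p ·))) t ∈ X) {n : ℤ} {x : Finset I →₀ k}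
    (hx : x ∈ chains k X n) (hDx : boundary k x = 0) :
    ∃ y ∈ chains k X (n + 1), boundary k y = x := by
  set h := cone k (fun t => w (t.filter (¬ p ·)))
  -- For a cycle `x`, the chain `x - boundary k (h x)` is a cycle with fewer vertices in the part
  -- that governs the apex, so induct on a strict bound `q` for their number. For `q = 0` only the
  -- zero chain is left.
  have main : ∀ (q : ℕ) (x : Finset I →₀ k),
      x ∈ chains k {u | u ∈ X ∧ (u.filter (¬ p ·)).card < q} n → boundary k x = 0 →
      ∃ y ∈ chains k X (n + 1), boundary k y = x := by
    intro q
    induction q with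
    | zero =>
      intro x hx _
      refine ⟨0, zero_mem _, ?_⟩
      rw [map_zero]
      ext t
      by_contra ht
      exact Nat.not_lt_zero _ (hx (Finsupp.mem_support_iff.mpr (Ne.symm ht))).1.2
    | succ q ih =>
      intro x hx hDx
      have hstep : x - boundary k (h x) - h (boundary k x) ∈
          chains k {u | u ∈ X ∧ (u.filter (¬ p ·)).card < q} n := by
        suffices hle : chains k {u | u ∈ X ∧ (u.filter (¬ p ·)).card < q + 1} n ≤
            (chains k {u | u ∈ X ∧ (u.filter (¬ p ·)).card < q} n).comap
              (LinearMap.id - boundary k ∘ₗ h - h ∘ₗ boundary k) from hle hx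
        refine chains_le fun t ht hn => ?_
        have := single_sub_homotopy_mem k hX p w hp hw ht.1
        rw [hn] at this
        refine Finsupp.supported_mono ?_ this
        rintro u ⟨⟨hu, hlt⟩, hc⟩
        exact ⟨⟨hu, hlt.trans_le (Nat.lt_succ_iff.mp ht.2)⟩, hc⟩
      rw [hDx, map_zero, sub_zero] at hstep
      obtain ⟨y, hy, hDy⟩ := ih _ hstep (by rw [map_sub, hDx, boundary_boundary, sub_zero])
      refine ⟨y + h x, add_mem hy (cone_mem_chains k hw ?_), by rw [map_add, hDy, sub_add_cancel]⟩
      refine Finsupp.supported_mono ?_ hx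
      rintro u ⟨⟨hu, -⟩, hc⟩
      exact ⟨hu, hc⟩
  -- A set of degree `n` has `n` vertices in all, so `n.toNat + 1` is a strict bound.
  refine main (n.toNat + 1) x (Finsupp.supported_mono ?_ hx) hDx
  rintro u ⟨hu, hc⟩
  refine ⟨⟨hu, ?_⟩, hc⟩
  have := Finset.card_filter_le u (¬ p ·)
  omega

end Boundary

/-- A version of `exists_boundary_eq` in which the vertices to be added are merely required to
exist. -/
theorem exists_boundary_eq_of_exists (k : Type*) [CommRing k] {I : Type*} [LinearOrder I]
    {X : Set (Finset I)} (hX : ∀ t ∈ X, ∀ y, t.erase y ∈ X) (p : I → Prop) [DecidablePred p]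
    (hp : ∀ t ∈ X, ∃ v, p v ∧ ∀ t' ∈ X, t'.filter (¬ p ·) = t.filter (¬ p ·) → insert v t' ∈ X)
    {n : ℤ} {x : Finset I →₀ k} (hx : x ∈ chains k X n) (hDx : boundary k x = 0) :
    ∃ y ∈ chains k X (n + 1), boundary k y = x := by
  by_cases hne : ∃ t, t ∈ X
  · obtain ⟨t₀, ht₀⟩ := hne
    -- `v₀` is a default apex for those `u` that do not occur as the governing part of a member of
    -- `X`.
    obtain ⟨v₀, -⟩ := hp t₀ ht₀
    have key : ∀ u : Finset I, ∃ v, ∀ t ∈ X, t.filter (¬ p ·) = u → p v ∧ insert v t ∈ X := by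
      intro u
      by_cases hu : ∃ t ∈ X, t.filter (¬ p ·) = u
      · obtain ⟨t, ht, rfl⟩ := hu
        obtain ⟨v, hv, hv'⟩ := hp t ht
        exact ⟨v, fun t' ht' h => ⟨hv, hv' t' ht' h⟩⟩
      · exact ⟨v₀, fun t ht h => (hu ⟨t, ht, h⟩).elim⟩
    choose w hw using key
    exact exists_boundary_eq k hX p w (fun t ht => (hw _ t ht rfl).1)
      (fun t ht => (hw _ t ht rfl).2) hx hDx
  · refine ⟨0, zero_mem _, ?_⟩
    rw [map_zero]
    ext t
    by_contra ht
    exact hne ⟨t, (hx (Finsupp.mem_support_iff.mpr (Ne.symm ht))).1⟩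

/-- A non-simplex contains an element of any simplicial complement. -/
theorem IsSimplicialComplement.exists_subset {V : Type*} {K : PreAbstractSimplicialComplex V}
    {P : Set (Finset V)} (hP : IsSimplicialComplement K P) {ρ : Finset V}
    (hρ : ¬ IsSimplex K ρ) : ∃ τ ∈ P, τ ⊆ ρ := by
  induction ρ using Finset.strongInduction with
  | H ρ ih =>
    -- Descend to a minimal non-simplex, which is a missing face.
    by_cases h : ∃ σ, σ ⊂ ρ ∧ ¬ IsSimplex K σ
    · obtain ⟨σ, hσ, hσ'⟩ := h
      obtain ⟨τ, hτ, hτσ⟩ := ih σ hσ hσ'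
      exact ⟨τ, hτ, hτσ.trans hσ.subset⟩
    · push Not at h
      exact ⟨ρ, hP.2 ρ ⟨hρ, h⟩, subset_rfl⟩

theorem isSimplex_fullSubcomplex {V : Type*} {K : PreAbstractSimplicialComplex V}
    {J ρ : Finset V} : IsSimplex (fullSubcomplex K J) ρ ↔ IsSimplex K ρ ∧ ρ ⊆ J := by
  constructor
  · rintro (rfl | h)
    · exact ⟨Or.inl rfl, Finset.empty_subset _⟩
    · exact ⟨Or.inr h.1, h.2⟩
  · rintro ⟨rfl | h, hJ⟩
    · exact Or.inl rfl
    · exact Or.inr ⟨h, hJ⟩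

/-! ### The auxiliary complex and its two acyclic subcomplexes -/

section Bicomplex

variable {V : Type*} [LinearOrder V] (P : Set (Finset V))

/-- The vertices of the auxiliary complex: the generators of the exterior algebra, followed by
the elements of the ground set. -/
abbrev Vert : Type _ := Gen P ⊕ₗ V

/-- The generators as vertices. -/
def genEmb : Gen P ↪o Vert P := OrderEmbedding.ofStrictMono _ Sum.Lex.inl_strictMono

/-- The elements of the ground set as vertices. -/
def vertEmb : V ↪o Vert P := OrderEmbedding.ofStrictMono _ Sum.Lex.inr_strictMono

theorem genEmb_ne_vertEmb (g : Gen P) (v : V) : genEmb P g ≠ vertEmb P v :=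
  fun h => Sum.inl_ne_inr (toLex.injective h)

theorem vert_cases (x : Vert P) : (∃ g, x = genEmb P g) ∨ ∃ v, x = vertEmb P v := by
  rcases h : ofLex x with g | v
  · exact Or.inl ⟨g, congrArg toLex h⟩
  · exact Or.inr ⟨v, congrArg toLex h⟩

variable {P}

/-- The generators in a set of vertices. -/
def gens (t : Finset (Vert P)) : Finset (Gen P) :=
  t.preimage (genEmb P) (genEmb P).injective.injOn

/-- The elements of the ground set in a set of vertices. -/
def verts (t : Finset (Vert P)) : Finset V :=
  t.preimage (vertEmb P) (vertEmb P).injective.injOn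

@[simp]
theorem mem_gens {t : Finset (Vert P)} {g : Gen P} : g ∈ gens t ↔ genEmb P g ∈ t :=
  Finset.mem_preimage

@[simp]
theorem mem_verts {t : Finset (Vert P)} {v : V} : v ∈ verts t ↔ vertEmb P v ∈ t :=
  Finset.mem_preimage

@[simp]
theorem gens_map (s : Finset (Gen P)) : gens (s.map (genEmb P).toEmbedding) = s := by
  ext g
  simp

@[simp]
theorem verts_map (σ : Finset V) : verts (σ.map (vertEmb P).toEmbedding) = σ := by
  ext v
  simp

theorem verts_map_genEmb (s : Finset (Gen P)) : verts (s.map (genEmb P).toEmbedding) = ∅ := by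
  ext v
  simp [genEmb_ne_vertEmb]

theorem gens_map_vertEmb (σ : Finset V) :
    gens (σ.map (vertEmb P).toEmbedding) = (∅ : Finset (Gen P)) := by
  ext g
  simp [(genEmb_ne_vertEmb P _ _).symm]

theorem eq_map_gens {t : Finset (Vert P)} (h : verts t = ∅) :
    t = (gens t).map (genEmb P).toEmbedding := by
  ext x
  rcases vert_cases P x with ⟨g, rfl⟩ | ⟨v, rfl⟩
  · simp
  · have : vertEmb P v ∉ t := fun hv => by simpa [h] using mem_verts.mpr hv
    simp [this, genEmb_ne_vertEmb]

theorem eq_map_verts {t : Finset (Vert P)} (h : gens t = ∅) :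
    t = (verts t).map (vertEmb P).toEmbedding := by
  ext x
  rcases vert_cases P x with ⟨g, rfl⟩ | ⟨v, rfl⟩
  · have : genEmb P g ∉ t := fun hg => by simpa [h] using mem_gens.mpr hg
    simp [this, (genEmb_ne_vertEmb P _ _).symm]
  · simp

theorem mem_totalSet {s : Finset (Gen P)} {v : V} :
    v ∈ totalSet s ↔ ∃ g ∈ s, v ∈ ofColex g.1 := by
  simp [totalSet]

theorem gens_mono {t u : Finset (Vert P)} (h : t ⊆ u) : gens t ⊆ gens u :=
  fun _ hg => mem_gens.mpr (h (mem_gens.mp hg))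

theorem verts_mono {t u : Finset (Vert P)} (h : t ⊆ u) : verts t ⊆ verts u :=
  fun _ hg => mem_verts.mpr (h (mem_verts.mp hg))

/-- The auxiliary simplicial complex: its simplices consist of a set of generators and a set of
elements of `J` outside the total set of the former. Its chains are the total complex of the
multidegree `J` part of the Taylor resolution tensored with the Koszul complex. -/
def bicomplex (P : Set (Finset V)) (J : Finset V) : Set (Finset (Vert P)) :=
  {t | verts t ⊆ J ∧ totalSet (gens t) ⊆ J \ verts t}

theorem bicomplex_mono {J : Finset V} {t u : Finset (Vert P)} (h : t ⊆ u)
    (hu : u ∈ bicomplex P J) : t ∈ bicomplex P J :=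
  ⟨(verts_mono h).trans hu.1, (totalSet_mono (gens_mono h)).trans
    (hu.2.trans (Finset.sdiff_subset_sdiff subset_rfl (verts_mono h)))⟩

/-- The subcomplex of the simplices whose generators do not cover `J`. -/
def nonCovering (P : Set (Finset V)) (J : Finset V) : Set (Finset (Vert P)) :=
  {t | t ∈ bicomplex P J ∧ totalSet (gens t) ≠ J}

/-- The subcomplex of the simplices whose complement in `J` is not a simplex of `K`. -/
def nonSimplicial (K : PreAbstractSimplicialComplex V) (P : Set (Finset V)) (J : Finset V) :
    Set (Finset (Vert P)) :=
  {t | t ∈ bicomplex P J ∧ ¬ IsSimplex K (J \ verts t)}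

theorem nonCovering_mono {J : Finset V} {t u : Finset (Vert P)} (h : t ⊆ u)
    (hu : u ∈ nonCovering P J) : t ∈ nonCovering P J := by
  refine ⟨bicomplex_mono h hu.1, fun hJ => hu.2 ?_⟩
  refine (hu.1.2.trans Finset.sdiff_subset).antisymm ?_
  rw [← hJ]
  exact totalSet_mono (gens_mono h)

theorem nonSimplicial_mono {K : PreAbstractSimplicialComplex V} {J : Finset V}
    {t u : Finset (Vert P)} (h : t ⊆ u) (hu : u ∈ nonSimplicial K P J) :
    t ∈ nonSimplicial K P J :=
  ⟨bicomplex_mono h hu.1, fun hs => hu.2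
    (hs.mono (Finset.sdiff_subset_sdiff subset_rfl (verts_mono h)))⟩

theorem isRight_vertEmb (v : V) : (ofLex (vertEmb P v)).isRight = true := rfl

theorem isLeft_genEmb (g : Gen P) : (ofLex (genEmb P g)).isLeft = true := rfl

/-- The apex is an element of `J` missed by the generators. Adding it leaves the generators, and
hence the uncovered set, unchanged. -/
theorem nonCovering_acyclic (k : Type*) [CommRing k] {J : Finset V} {n : ℤ}
    {x : Finset (Vert P) →₀ k} (hx : x ∈ chains k (nonCovering P J) n)
    (hDx : boundary k x = 0) :
    ∃ y ∈ chains k (nonCovering P J) (n + 1), boundary k y = x := by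
  refine exists_boundary_eq_of_exists k
    (fun t ht y => nonCovering_mono (Finset.erase_subset _ _) ht)
    (fun x => (ofLex x).isRight = true) (fun t ht => ?_) hx hDx
  obtain ⟨v, hvJ, hv⟩ : ∃ v ∈ J, v ∉ totalSet (gens t) := by
    by_contra! h
    exact ht.2 ((ht.1.2.trans Finset.sdiff_subset).antisymm h)
  refine ⟨vertEmb P v, isRight_vertEmb v, fun t' ht' hfil => ?_⟩
  have hg : gens t' = gens t := by
    ext g
    have := Finset.ext_iff.mp hfil (genEmb P g)
    simpa [isLeft_genEmb] using this
  have hg' : gens (insert (vertEmb P v) t') = gens t' := by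
    ext g
    simp [genEmb_ne_vertEmb]
  have hv' : verts (insert (vertEmb P v) t') = insert v (verts t') := by
    ext z
    simp
  refine ⟨⟨?_, ?_⟩, hg' ▸ ht'.2⟩
  · rw [hv']
    exact Finset.insert_subset hvJ ht'.1.1
  · rw [hg', hv']
    intro z hz
    have := Finset.mem_sdiff.mp (ht'.1.2 hz)
    refine Finset.mem_sdiff.mpr ⟨this.1, fun h => ?_⟩
    rcases Finset.mem_insert.mp h with rfl | h
    · exact hv (hg ▸ hz)
    · exact this.2 h

/-- The apex is an element of `P` inside the non-simplex `J \ verts t`. Adding it leaves `verts t`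
unchanged. -/
theorem nonSimplicial_acyclic (k : Type*) [CommRing k] {K : PreAbstractSimplicialComplex V}
    (hP : IsSimplicialComplement K P) {J : Finset V} {n : ℤ}
    {x : Finset (Vert P) →₀ k} (hx : x ∈ chains k (nonSimplicial K P J) n)
    (hDx : boundary k x = 0) :
    ∃ y ∈ chains k (nonSimplicial K P J) (n + 1), boundary k y = x := by
  refine exists_boundary_eq_of_exists k
    (fun t ht y => nonSimplicial_mono (Finset.erase_subset _ _) ht)
    (fun x => (ofLex x).isLeft = true) (fun t ht => ?_) hx hDx
  obtain ⟨τ, hτP, hτ⟩ := hP.exists_subset ht.2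
  refine ⟨genEmb P ⟨toColex τ, hτP⟩, isLeft_genEmb _, fun t' ht' hfil => ?_⟩
  have hv : verts t' = verts t := by
    ext v
    have := Finset.ext_iff.mp hfil (vertEmb P v)
    simpa [isRight_vertEmb] using this
  have hg' : gens (insert (genEmb P ⟨toColex τ, hτP⟩) t') = insert ⟨toColex τ, hτP⟩ (gens t') := by
    ext g
    simp
  have hv' : verts (insert (genEmb P ⟨toColex τ, hτP⟩) t') = verts t' := by
    ext z
    simp [(genEmb_ne_vertEmb P _ _).symm]
  refine ⟨⟨hv'.symm ▸ ht'.1.1, ?_⟩, hv'.symm ▸ ht'.2⟩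
  rw [hg', hv']
  intro z hz
  obtain ⟨g, hg, hzg⟩ := mem_totalSet.mp hz
  rcases Finset.mem_insert.mp hg with rfl | hg
  · rw [hv]
    exact hτ hzg
  · exact ht'.1.2 (mem_totalSet.mpr ⟨g, hg, hzg⟩)

/-- Ground elements of `t` lie in `J` but avoid the total set, which leaves no room when the
generators cover `J`. -/
theorem bicomplex_verts_eq_empty {J : Finset V} {t : Finset (Vert P)} (ht : t ∈ bicomplex P J)
    (hJ : totalSet (gens t) = J) : verts t = ∅ := by
  refine Finset.eq_empty_of_forall_notMem fun v hv => ?_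
  have h := ht.2 (hJ.symm ▸ ht.1 hv)
  exact (Finset.mem_sdiff.mp h).2 hv

/-- A generator of `t` would be a subset of a simplex, hence a simplex, which elements of `P` are
not. -/
theorem bicomplex_gens_eq_empty {K : PreAbstractSimplicialComplex V}
    (hP : IsSimplicialComplement K P) {J : Finset V} {t : Finset (Vert P)}
    (ht : t ∈ bicomplex P J) (hs : IsSimplex K (J \ verts t)) : gens t = ∅ := by
  refine Finset.eq_empty_of_forall_notMem fun g hg => ?_
  exact hP.1 _ g.2 (hs.mono fun v hv => ht.2 (mem_totalSet.mpr ⟨g, hg, hv⟩))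

end Bicomplex

/-! ### The two quotients and the comparison of their homology -/

section Comparison

variable (k : Type*) [CommRing k] {V : Type*} [LinearOrder V]

theorem chains_mono {I : Type*} {X Y : Set (Finset I)} (h : X ⊆ Y) (n : ℤ) :
    chains k X n ≤ chains k Y n :=
  Finsupp.supported_mono fun _ ht => ⟨h ht.1, ht.2⟩

/-! ### Projection onto the exterior algebra -/

variable (P : Set (Finset V))

instance instFiniteGen [Finite V] : Finite (Gen P) :=
  Finite.of_injective (fun g : Gen P => ofColex g.1)
    (ofColex.injective.comp Subtype.val_injective)

/-- The projection of the auxiliary complex to `Λ^{*,J}[P]`. -/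
def toLam [Finite V] (J : Finset V) : (Finset (Vert P) →₀ k) →ₗ[k] Lam k P :=
  (monomial k P).equivFun.symm.toLinearMap ∘ₗ LinearMap.pi fun s =>
    if totalSet s = J then Finsupp.lapply (s.map (genEmb P).toEmbedding) else 0

variable [Finite V] (J : Finset V)

theorem equivFun_toLam (x : Finset (Vert P) →₀ k) (s : Finset (Gen P)) :
    (monomial k P).equivFun (toLam k P J x) s =
      if totalSet s = J then x (s.map (genEmb P).toEmbedding) else 0 := by
  simp only [toLam, LinearMap.comp_apply, LinearEquiv.coe_coe, LinearEquiv.apply_symm_apply,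
    LinearMap.pi_apply]
  split_ifs <;> rfl

theorem toLam_single_map (s : Finset (Gen P)) :
    toLam k P J (Finsupp.single (s.map (genEmb P).toEmbedding) 1) =
      if totalSet s = J then monomial k P s else 0 := by
  classical
  apply (monomial k P).equivFun.injective
  ext s'
  rw [equivFun_toLam, Finsupp.single_apply]
  simp only [Finset.map_inj]
  by_cases h : s = s'
  · subst h
    rw [if_pos rfl]
    split_ifs <;> simp
  · split_ifs <;> simp [h]

theorem toLam_eq_zero {n : ℤ} {x : Finset (Vert P) →₀ k}
    (hx : x ∈ chains k (nonCovering P J) n) : toLam k P J x = 0 := by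
  apply (monomial k P).equivFun.injective
  ext s
  rw [equivFun_toLam, map_zero, Pi.zero_apply]
  split_ifs with hs
  · by_contra hne
    refine (hx (Finsupp.mem_support_iff.mpr hne)).1.2 ?_
    rwa [gens_map]
  · rfl

/-- Covering simplices consist of generators alone, so `toLam` sees all their coefficients. With
`toLam_eq_zero` this identifies its kernel on the auxiliary complex. -/
theorem mem_nonCovering_of_toLam_eq_zero {n : ℤ} {x : Finset (Vert P) →₀ k}
    (hx : x ∈ chains k (bicomplex P J) n) (h : toLam k P J x = 0) :
    x ∈ chains k (nonCovering P J) n := by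
  intro t ht
  obtain ⟨htA, htn⟩ := hx ht
  refine ⟨⟨htA, fun hJ => Finsupp.mem_support_iff.mp ht ?_⟩, htn⟩
  have := equivFun_toLam k P J x (gens t)
  rw [h, map_zero, if_pos hJ, ← eq_map_gens (bicomplex_verts_eq_empty htA hJ)] at this
  exact this.symm

/-- The factor `δⱼ` arises because `toLam` kills every face that no longer covers `J`. -/
theorem toLam_boundary {n : ℤ} {x : Finset (Vert P) →₀ k}
    (hx : x ∈ chains k (bicomplex P J) n) :
    toLam k P J (boundary k x) = d k P (toLam k P J x) := by
  suffices h : chains k (bicomplex P J) n ≤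
      LinearMap.eqLocus (toLam k P J ∘ₗ boundary k) (d k P ∘ₗ toLam k P J) from h hx
  refine chains_le fun t ht hn => ?_
  rw [LinearMap.mem_eqLocus, LinearMap.comp_apply, LinearMap.comp_apply]
  by_cases hJ : totalSet (gens t) = J
  · obtain ⟨s, rfl⟩ : ∃ s : Finset (Gen P), t = s.map (genEmb P).toEmbedding :=
      ⟨_, eq_map_gens (bicomplex_verts_eq_empty ht hJ)⟩
    rw [gens_map] at hJ
    rw [toLam_single_map, if_pos hJ, d_monomial, boundary_single, map_sum, Finset.sum_map]
    refine Finset.sum_congr rfl fun τ _ => ?_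
    rw [map_smul, ← Finset.map_erase, toLam_single_map, hJ]
    congr 1
    exact sgn_map k (genEmb P) s τ
  · have hmem := single_mem_chains k (X := nonCovering P J) ⟨ht, hJ⟩ hn
    rw [toLam_eq_zero k P J hmem, map_zero]
    exact toLam_eq_zero k P J (boundary_mem_chains k
      (fun t ht y => nonCovering_mono (Finset.erase_subset _ _) ht) hmem)

theorem map_toLam (i : ℕ) :
    (chains k (bicomplex P J) i).map (toLam k P J) = LamPart k P i J := by
  apply le_antisymm
  · rw [Submodule.map_le_iff_le_comap]
    refine chains_le fun t ht hn => ?_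
    rw [Submodule.mem_comap]
    by_cases hJ : totalSet (gens t) = J
    · have h := eq_map_gens (bicomplex_verts_eq_empty ht hJ)
      have hc : (gens t).card = i := by
        rw [h, Finset.card_map] at hn
        exact_mod_cast hn
      rw [h, toLam_single_map, if_pos hJ]
      exact Submodule.subset_span ⟨_, hc, hJ, rfl⟩
    · rw [toLam_eq_zero k P J (single_mem_chains k (X := nonCovering P J) ⟨ht, hJ⟩ hn)]
      exact zero_mem _
  · refine Submodule.span_le.mpr ?_
    rintro _ ⟨s, hs, hJ, rfl⟩
    refine ⟨Finsupp.single (s.map (genEmb P).toEmbedding) 1, single_mem_chains k ⟨?_, ?_⟩ ?_, ?_⟩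
    · rw [verts_map_genEmb]
      exact Finset.empty_subset _
    · rw [verts_map_genEmb, gens_map, hJ, Finset.sdiff_empty]
    · rw [Finset.card_map, hs]
    · rw [toLam_single_map, if_pos hJ]

/-! ### Projection onto the cochains of the full subcomplex -/

/-- The sign that relates the boundary of a subset of `J` to the coboundary of its complement. -/
def complSign (σ : Finset V) : k := ∏ v ∈ σ, sgn k J v

omit [Finite V] in
theorem complSign_mul_self (σ : Finset V) : complSign k J σ * complSign k J σ = 1 := by
  rw [complSign, ← Finset.prod_mul_distrib]
  exact Finset.prod_eq_one fun v _ => sgn_mul_self k J v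

omit [Finite V] in
variable {J} in
-- The elements of `J` below `v` are split between `ρ` and `J \ ρ`; inserting `v` does not affect
-- the count.
theorem sgn_mul_sgn_compl {ρ : Finset V} (hρ : ρ ⊆ J) (v : V) :
    sgn k ρ v * sgn k (insert v (J \ ρ)) v = sgn k J v := by
  rw [sgn, sgn, sgn, ← pow_add, Finset.filter_insert, if_neg (lt_irrefl v),
    ← Finset.card_union_of_disjoint, ← Finset.filter_union, Finset.union_sdiff_of_subset hρ]
  exact Finset.disjoint_filter_filter Finset.disjoint_sdiff

variable (K : PreAbstractSimplicialComplex V)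

/-- The projection of the auxiliary complex to the cochains of the full subcomplex on `J`. -/
def toCochain : (Finset (Vert P) →₀ k) →ₗ[k] Cochain k (fullSubcomplex K J) :=
  LinearMap.pi fun ρ =>
    complSign k J (J \ ρ.1) • Finsupp.lapply ((J \ ρ.1).map (vertEmb P).toEmbedding)

omit [Finite V] in
theorem toCochain_apply (x : Finset (Vert P) →₀ k)
    (ρ : {σ : Finset V // IsSimplex (fullSubcomplex K J) σ}) :
    toCochain k P J K x ρ =
      complSign k J (J \ ρ.1) * x ((J \ ρ.1).map (vertEmb P).toEmbedding) := rfl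

omit [Finite V] in
theorem toCochain_eq_zero {n : ℤ} {x : Finset (Vert P) →₀ k}
    (hx : x ∈ chains k (nonSimplicial K P J) n) : toCochain k P J K x = 0 := by
  ext ρ
  obtain ⟨hρ, hρJ⟩ := isSimplex_fullSubcomplex.mp ρ.2
  rw [toCochain_apply, Pi.zero_apply]
  convert mul_zero _
  by_contra hne
  refine (hx (Finsupp.mem_support_iff.mpr hne)).1.2 ?_
  rwa [verts_map, Finset.sdiff_sdiff_eq_self hρJ]

variable {P K}

omit [Finite V] in
theorem mem_nonSimplicial_of_toCochain_eq_zero (hP : IsSimplicialComplement K P) {n : ℤ}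
    {x : Finset (Vert P) →₀ k} (hx : x ∈ chains k (bicomplex P J) n)
    (h : toCochain k P J K x = 0) : x ∈ chains k (nonSimplicial K P J) n := by
  intro t ht
  obtain ⟨htA, htn⟩ := hx ht
  refine ⟨⟨htA, fun hs => Finsupp.mem_support_iff.mp ht ?_⟩, htn⟩
  have := toCochain_apply k P J K x
    ⟨J \ verts t, isSimplex_fullSubcomplex.mpr ⟨hs, Finset.sdiff_subset⟩⟩
  rw [h, Finset.sdiff_sdiff_eq_self htA.1,
    ← eq_map_verts (bicomplex_gens_eq_empty hP htA hs)] at this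
  rw [← one_mul (x t), ← complSign_mul_self k J (verts t), mul_assoc, ← this, Pi.zero_apply,
    mul_zero]

/-- Adding `v` to `J \ ρ` amounts to erasing `v` from `ρ`. The two signs differ by `sgn k J v`,
which is the change in `complSign`. -/
theorem toCochain_boundary (hP : IsSimplicialComplement K P) {n : ℤ}
    {x : Finset (Vert P) →₀ k} (hx : x ∈ chains k (bicomplex P J) n) :
    toCochain k P J K (boundary k x) =
      coboundary k (fullSubcomplex K J) (toCochain k P J K x) := by
  have : Finite (Vert P) := inferInstanceAs (Finite (Gen P ⊕ V))
  have := Fintype.ofFinite (Vert P)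
  ext ⟨ρ, hρK⟩
  obtain ⟨hρ, hρJ⟩ := isSimplex_fullSubcomplex.mp hρK
  set u := (J \ ρ).map (vertEmb P).toEmbedding with hu
  have hsub : ρ.map (vertEmb P).toEmbedding ⊆ uᶜ := by
    intro y hy
    obtain ⟨v, hv, rfl⟩ := Finset.mem_map.mp hy
    simp [hu, hv]
  rw [toCochain_apply, boundary_apply, ← Finset.sum_subset hsub, Finset.sum_map, Finset.mul_sum]
  · change _ = ∑ v ∈ ρ, _
    refine Finset.sum_congr rfl fun v hv => ?_
    have hvn : v ∉ J \ ρ := by simp [hv]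
    have hins : J \ ρ.erase v = insert v (J \ ρ) := by
      rw [Finset.sdiff_erase (hρJ hv)]
    have hsgn := sgn_map k (vertEmb P) (insert v (J \ ρ)) v
    have hmap : insert ((vertEmb P).toEmbedding v) u =
        (insert v (J \ ρ)).map (vertEmb P).toEmbedding := by
      rw [hu, Finset.map_insert]
    rw [toCochain_apply]
    simp only
    rw [hins, hmap, complSign, complSign, Finset.prod_insert hvn, ← sgn_mul_sgn_compl k hρJ v]
    change _ * (sgn k _ ((vertEmb P) v) * _) = _
    rw [hsgn]
    linear_combination (-(∏ v ∈ J \ ρ, sgn k J v) * sgn k (insert v (J \ ρ)) v *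
      x ((insert v (J \ ρ)).map (vertEmb P).toEmbedding)) * sgn_mul_self k ρ v
  -- No other vertex contributes: adding a generator, or an element outside `J`, to `J \ ρ` leaves
  -- the auxiliary complex.
  · intro y hyu hy
    convert mul_zero _
    by_contra hne
    have hA := (hx (Finsupp.mem_support_iff.mpr hne)).1
    rcases vert_cases P y with ⟨g, rfl⟩ | ⟨v, rfl⟩
    · have hv : verts (insert (genEmb P g) u) = J \ ρ := by
        ext z
        simp [hu, (genEmb_ne_vertEmb P _ _).symm]
      have := bicomplex_gens_eq_empty hP hA (by rwa [hv, Finset.sdiff_sdiff_eq_self hρJ])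
      have hg : g ∈ gens (insert (genEmb P g) u) := by simp
      exact Finset.notMem_empty _ (this ▸ hg)
    · have hvJ : v ∈ J := hA.1 (by simp)
      simp [hu] at hyu hy
      exact hy (hyu hvJ)

theorem map_toCochain (hP : IsSimplicialComplement K P) (i : ℤ) :
    (chains k (bicomplex P J) i).map (toCochain k P J K) =
      cochains k (fullSubcomplex K J) ((J.card : ℤ) - i - 1) := by
  have : Finite (Vert P) := inferInstanceAs (Finite (Gen P ⊕ V))
  apply le_antisymm
  · rintro _ ⟨x, hx, rfl⟩ ⟨ρ, hρK⟩ hρ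
    rw [toCochain_apply]
    convert mul_zero _
    by_contra hne
    have hn := (hx (Finsupp.mem_support_iff.mpr hne)).2
    have hρJ := (isSimplex_fullSubcomplex.mp hρK).2
    rw [Finset.card_map, Finset.card_sdiff_of_subset hρJ] at hn
    have := Finset.card_le_card hρJ
    simp only at hρ hn
    omega
  · intro g hg
    classical
    -- The two conditions together force `t` to contain no generators, so `t` is determined by
    -- `verts t`. As `complSign` squares to one, it serves as its own inverse.
    let x : Finset (Vert P) →₀ k := Finsupp.equivFunOnFinite.symm fun t =>
      if h : IsSimplex (fullSubcomplex K J) (J \ verts t) ∧ t ∈ bicomplex P J then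
        complSign k J (verts t) * g ⟨J \ verts t, h.1⟩ else 0
    refine ⟨x, ?_, ?_⟩
    · intro t ht
      have hne : x t ≠ 0 := Finsupp.mem_support_iff.mp ht
      change (if h : _ then _ else _) ≠ (0 : k) at hne
      split_ifs at hne with h
      · refine ⟨h.2, ?_⟩
        have hg0 : g ⟨J \ verts t, h.1⟩ ≠ 0 := right_ne_zero_of_mul hne
        have hc := not_not.mp (mt (hg ⟨J \ verts t, h.1⟩) hg0)
        rw [eq_map_verts (bicomplex_gens_eq_empty hP h.2 (isSimplex_fullSubcomplex.mp h.1).1),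
          Finset.card_map]
        have hle := Finset.card_le_card h.2.1
        simp only [Finset.card_sdiff_of_subset h.2.1] at hc
        omega
      · exact (hne rfl).elim
    · ext ⟨ρ, hρK⟩
      have hρJ := (isSimplex_fullSubcomplex.mp hρK).2
      have hρ : J \ (J \ ρ) = ρ := Finset.sdiff_sdiff_eq_self hρJ
      rw [toCochain_apply]
      change _ * (if h : _ then _ else _) = _
      rw [dif_pos]
      · rw [← mul_assoc]
        simp only [verts_map, complSign_mul_self, one_mul, hρ]
      · refine ⟨by rwa [verts_map, hρ], ?_, ?_⟩
        · rw [verts_map]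
          exact Finset.sdiff_subset
        · rw [gens_map_vertEmb]
          exact Finset.empty_subset _

variable (P) in
/-- The homology of `Λ^{*,J}[P]` is the reduced cohomology of the full subcomplex on `J`. -/
theorem nonempty_lamHomology_equiv (hP : IsSimplicialComplement K P) (i : ℕ) :
    Nonempty (LamHomology k P i J ≃ₗ[k]
      ReducedCohomology k (fullSubcomplex K J) ((J.card : ℤ) - (i : ℤ) - 1)) := by
  have hA : ∀ n : ℤ, ∀ x ∈ chains k (bicomplex P J) n,
      boundary k x ∈ chains k (bicomplex P J) (n - 1) := fun n x =>
    boundary_mem_chains k fun t ht y => bicomplex_mono (Finset.erase_subset _ _) ht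
  have hA' : ∀ x ∈ chains k (bicomplex P J) ((i : ℤ) + 1),
      boundary k x ∈ chains k (bicomplex P J) i := fun x hx => by
    simpa using hA _ x hx
  have hL : ∀ n : ℤ, ∀ x ∈ chains k (bicomplex P J) n, toLam k P J x = 0 → boundary k x = 0 →
      ∃ y ∈ chains k (bicomplex P J) (n + 1), toLam k P J y = 0 ∧ boundary k y = x := by
    intro n x hx h0 hD
    obtain ⟨y, hy, hDy⟩ := nonCovering_acyclic k (mem_nonCovering_of_toLam_eq_zero k P J hx h0) hD
    exact ⟨y, chains_mono k (fun _ h => h.1) _ hy, toLam_eq_zero k P J hy, hDy⟩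
  have hC : ∀ n : ℤ, ∀ x ∈ chains k (bicomplex P J) n, toCochain k P J K x = 0 →
      boundary k x = 0 →
      ∃ y ∈ chains k (bicomplex P J) (n + 1), toCochain k P J K y = 0 ∧ boundary k y = x := by
    intro n x hx h0 hD
    obtain ⟨y, hy, hDy⟩ := nonSimplicial_acyclic k hP
      (mem_nonSimplicial_of_toCochain_eq_zero k J hP hx h0) hD
    exact ⟨y, chains_mono k (fun _ h => h.1) _ hy, toCochain_eq_zero k P J K hy, hDy⟩
  -- Integer degrees cover `i = 0` as well: there are no nonzero chains of degree `-1`.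
  obtain ⟨e₁⟩ := nonempty_homologyEquiv (boundary k) (d k P) (toLam k P J)
    (chains k (bicomplex P J) ((i : ℤ) - 1)) (chains k (bicomplex P J) i)
    (chains k (bicomplex P J) ((i : ℤ) + 1)) (LamPart k P i J) (LamPart k P (i + 1) J)
    (boundary_boundary k) (hA i) hA' (fun x hx => toLam_boundary k P J hx)
    (fun x hx => toLam_boundary k P J hx) (map_toLam k P J i)
    (by exact_mod_cast map_toLam k P J (i + 1))
    (fun x hx h0 hD => by simpa using hL _ x hx h0 hD) (hL i)
  obtain ⟨e₂⟩ := nonempty_homologyEquiv (boundary k) (coboundary k (fullSubcomplex K J))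
    (toCochain k P J K)
    (chains k (bicomplex P J) ((i : ℤ) - 1)) (chains k (bicomplex P J) i)
    (chains k (bicomplex P J) ((i : ℤ) + 1))
    (cochains k (fullSubcomplex K J) ((J.card : ℤ) - i - 1))
    -- Complementation reverses degrees: chains of degree `i + 1` become the cochains one degree
    -- lower, whose images are the coboundaries.
    (cochains k (fullSubcomplex K J) ((J.card : ℤ) - i - 1 - 1))
    (boundary_boundary k) (hA i) hA' (fun x hx => toCochain_boundary k J hP hx)
    (fun x hx => toCochain_boundary k J hP hx) (map_toCochain k J hP i)
    (by rw [map_toCochain k J hP, sub_add_eq_sub_sub, sub_right_comm _ (1 : ℤ)])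
    (fun x hx h0 hD => by simpa using hC _ x hx h0 hD) (hC i)
  exact ⟨e₁.symm.trans e₂⟩

end Comparison

end

end SimplicialComplement

theorem corollary1p5 {k : Type*} [CommRing k] (hk : IsField k ∨ Nonempty (k ≃+* ℤ))
    {m : ℕ} (K : PreAbstractSimplicialComplex (Fin m)) (P : Set (Finset (Fin m)))
    (hP : SimplicialComplement.IsSimplicialComplement K P) (J : Finset (Fin m)) (i : ℕ) :
    Nonempty (SimplicialComplement.LamHomology k P i J ≃ₗ[k]
      SimplicialComplement.ReducedCohomology k (SimplicialComplement.fullSubcomplex K J)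
        ((J.card : ℤ) - (i : ℤ) - 1)) :=
  SimplicialComplement.nonempty_lamHomology_equiv k P J hP i
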